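/- Let $\mathbf{H}^3$ be hyperbolic $3$-space in the upper half space model $\mathbb{C}\times(0,\infty)$, with its distance $d$ of constant curvature $-1$, given by $\sinh\big(\tfrac12 d(p,q)\big)=\dfrac{|p-q|}{2\sqrt{ts}}$, where $t,s$ are the heights of $p,q$ and $|p-q|$ is the Euclidean distance. Let $\mathbf{S}=\mathbb{C}\cup\{\infty\}$ be the Riemann sphere, and give $\mathbf{H}^3\cup\mathbf{S}$ the topology of the closed upper half space $\mathbb{C}\times[0,\infty)$ (with $\mathbb{C}=\mathbb{C}\times\{0\}$) together with $\infty$, as a subspace of the one-point compactification of $\mathbb{C}\times\mathbb{R}$. A bijection $H:\mathbf{H}^3\to\mathbf{H}^3$ is *bi-Lipschitz* if there is $K\ge 1$ with $K^{-1}d(x,y)\le d(H(x),H(y))\le K\,d(x,y)$ for all $x,y$. A homeomorphism $h:\mathbf{S}\to\mathbf{S}$ is a *continuous extension* of $H$ if the map of $\mathbf{H}^3\cup\mathbf{S}$ that equals $H$ on $\mathbf{H}^3$ and $h$ on $\mathbf{S}$ is continuous. A *nice lattice* is a group $\Gamma$ of isometries of $\mathbf{H}^3$ such that $\mathbf{H}^3/\Gamma$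 is a compact (Hausdorff) manifold and $\mathbf{H}^3\to\mathbf{H}^3/\Gamma$ is a covering map with deck group $\Gamma$; its elements act on $\mathbf{S}$ through their continuous extensions. **Theorem.** Every bi-Lipschitz map $H:\mathbf{H}^3\to\mathbf{H}^3$ has a continuous extension to a homeomorphism $h:\mathbf{S}\to\mathbf{S}$. Moreover, whenever $\Gamma_1,\Gamma_2$ are nice lattices with $H\Gamma_1H^{-1}=\Gamma_2$ (as groups of bijections of $\mathbf{H}^3$), one also has $h\Gamma_1h^{-1}=\Gamma_2$ (as groups of homeomorphisms of $\mathbf{S}$). -/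

import Mathlib

noncomputable section

/-- A bi-Lipschitz (BL) map of metric spaces: a bijection distorting distances by at most a
constant factor `K ≥ 1` in both directions. -/
def IsBL {X₁ X₂ : Type*} [MetricSpace X₁] [MetricSpace X₂] (H : X₁ → X₂) : Prop :=
  Function.Bijective H ∧
    ∃ K : ℝ, 1 ≤ K ∧ ∀ x y : X₁, K⁻¹ * dist x y ≤ dist (H x) (H y) ∧ dist (H x) (H y) ≤ K * dist x y

/-- The points of hyperbolic 3-space in the upper half space model `ℂ × (0, ∞)`. -/
@[ext]
structure H3 where
  z : ℂ
  t : ℝ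
  t_pos : 0 < t

namespace H3

/-- The point as an element of `ℂ × ℝ` with its Euclidean norm. -/
def toEuclidean (p : H3) : WithLp 2 (ℂ × ℝ) := WithLp.toLp 2 (p.z, p.t)

/-- The mirror image of the point in the plane `t = 0`. -/
def mirror (p : H3) : WithLp 2 (ℂ × ℝ) := WithLp.toLp 2 (p.z, -p.t)

/-- The hyperbolic distance (curvature `-1`), given by the same formula as on Mathlib's upper half
plane: `sinh (d / 2) = |p - q| / (2 √(t s))`, where `|p - q|` is Euclidean and `t`, `s` are the
heights of `p`, `q`. -/
instance : Dist H3 :=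
  ⟨fun p q => 2 * Real.arsinh (dist p.toEuclidean q.toEuclidean / (2 * √(p.t * q.t)))⟩

theorem dist_def (p q : H3) :
    dist p q = 2 * Real.arsinh (dist p.toEuclidean q.toEuclidean / (2 * √(p.t * q.t))) := rfl

theorem dist_toEuclidean_sq (p q : H3) :
    dist p.toEuclidean q.toEuclidean ^ 2 = dist p.z q.z ^ 2 + (p.t - q.t) ^ 2 := by
  rw [WithLp.prod_dist_eq_of_L2, Real.sq_sqrt (by positivity)]
  simp [toEuclidean, Real.dist_eq, sq_abs]

theorem dist_mirror_sq (p q : H3) :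
    dist p.toEuclidean q.mirror ^ 2 = dist p.z q.z ^ 2 + (p.t + q.t) ^ 2 := by
  rw [WithLp.prod_dist_eq_of_L2, Real.sq_sqrt (by positivity)]
  simp [toEuclidean, mirror, Real.dist_eq, sq_abs]

theorem dist_mirror_comm (p q : H3) :
    dist p.toEuclidean q.mirror = dist q.toEuclidean p.mirror := by
  rw [← sq_eq_sq₀ dist_nonneg dist_nonneg, dist_mirror_sq, dist_mirror_sq, dist_comm, add_comm p.t]

theorem dist_self_mirror (p : H3) : dist p.toEuclidean p.mirror = 2 * p.t := by
  have := p.t_pos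
  rw [← sq_eq_sq₀ dist_nonneg (by positivity), dist_mirror_sq, dist_self]
  ring

theorem sinh_half_dist (p q : H3) :
    Real.sinh (dist p q / 2) = dist p.toEuclidean q.toEuclidean / (2 * √(p.t * q.t)) := by
  rw [dist_def, mul_div_cancel_left₀ _ two_ne_zero, Real.sinh_arsinh]

theorem cosh_half_dist (p q : H3) :
    Real.cosh (dist p q / 2) = dist p.toEuclidean q.mirror / (2 * √(p.t * q.t)) := by
  have hp := p.t_pos
  have hq := q.t_pos
  rw [← sq_eq_sq₀ (Real.cosh_pos _).le (by positivity), Real.cosh_sq', sinh_half_dist, div_pow,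
    div_pow, mul_pow, Real.sq_sqrt (by positivity), dist_toEuclidean_sq, dist_mirror_sq]
  field_simp
  ring

protected theorem dist_triangle (a b c : H3) : dist a c ≤ dist a b + dist b c := by
  have ha := a.t_pos
  have hb := b.t_pos
  have hc := c.t_pos
  have pt := EuclideanGeometry.mul_dist_le_mul_dist_add_mul_dist
    a.toEuclidean b.toEuclidean c.toEuclidean b.mirror
  rw [dist_self_mirror, dist_mirror_comm c b] at pt
  have key : Real.sinh (dist a c / 2) ≤ Real.sinh (dist a b / 2 + dist b c / 2) := by
    rw [Real.sinh_add, sinh_half_dist, sinh_half_dist, sinh_half_dist, cosh_half_dist,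
      cosh_half_dist, Real.sqrt_mul ha.le, Real.sqrt_mul ha.le, Real.sqrt_mul hb.le]
    have hb' : b.t = √b.t * √b.t := (Real.mul_self_sqrt hb.le).symm
    have ha0 : 0 < √a.t := Real.sqrt_pos.2 ha
    have hb0 : 0 < √b.t := Real.sqrt_pos.2 hb
    have hc0 : 0 < √c.t := Real.sqrt_pos.2 hc
    rw [div_mul_div_comm, div_mul_div_comm, ← add_div, div_le_div_iff₀ (by positivity)
      (by positivity)]
    have h2 : 0 ≤ 2 * (√a.t * √c.t) := by positivity
    calc dist a.toEuclidean c.toEuclidean * (2 * (√a.t * √b.t) * (2 * (√b.t * √c.t)))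
        = dist a.toEuclidean c.toEuclidean * (2 * (√b.t * √b.t)) * (2 * (√a.t * √c.t)) := by ring
      _ = dist a.toEuclidean c.toEuclidean * (2 * b.t) * (2 * (√a.t * √c.t)) := by rw [← hb']
      _ ≤ _ := mul_le_mul_of_nonneg_right (by linarith) h2
  rw [Real.sinh_le_sinh] at key
  linarith

instance : MetricSpace H3 where
  dist := dist
  dist_self p := by simp [dist_def]
  dist_comm p q := by simp only [dist_def, dist_comm p.toEuclidean, mul_comm p.t]
  dist_triangle := H3.dist_triangle
  eq_of_dist_eq_zero {p q} h := by
    have hp := p.t_pos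
    have hq := q.t_pos
    have h0 : dist p.toEuclidean q.toEuclidean = 0 := by
      have := sinh_half_dist p q
      rw [h, zero_div, Real.sinh_zero, eq_comm, div_eq_zero_iff] at this
      exact this.resolve_right (by positivity)
    have h1 : p.toEuclidean = q.toEuclidean := dist_eq_zero.1 h0
    simp only [toEuclidean, (WithLp.toLp_injective 2).eq_iff, Prod.mk.injEq] at h1
    exact H3.ext h1.1 h1.2

/-- The isometry group acts on hyperbolic space by evaluation. -/
instance : MulAction (H3 ≃ᵢ H3) H3 where
  smul g p := g p
  one_smul _ := rfl
  mul_smul _ _ _ := rfl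

end H3

/-- The Riemann sphere `ℂ ∪ {∞}`. -/
abbrev RiemannSphere : Type := OnePoint ℂ

/-- Hyperbolic 3-space together with its ideal boundary, the Riemann sphere. -/
inductive ClosedH3 : Type
  | interior (p : H3) : ClosedH3
  | ideal (ξ : RiemannSphere) : ClosedH3

namespace ClosedH3

/-- The inclusion of the closed half space `ℂ × [0, ∞)`, with a point at infinity added, in the
one-point compactification of `ℂ × ℝ`; the Riemann sphere is `(ℂ × {0}) ∪ {∞}`. -/
def toOnePoint : ClosedH3 → OnePoint (ℂ × ℝ)
  | interior p => ((p.z, p.t) : ℂ × ℝ)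
  | ideal ξ => OnePoint.map (fun z : ℂ => ((z, 0) : ℂ × ℝ)) ξ

/-- The topology of the closed ball. -/
instance : TopologicalSpace ClosedH3 := TopologicalSpace.induced toOnePoint inferInstance

/-- The map which is `H` on hyperbolic space and `h` on the Riemann sphere. -/
def glue (H : H3 → H3) (h : RiemannSphere → RiemannSphere) : ClosedH3 → ClosedH3
  | interior p => interior (H p)
  | ideal ξ => ideal (h ξ)

end ClosedH3

/-- `h` is a continuous extension of `H` to the Riemann sphere: together they form a continuous
self-map of hyperbolic space with its ideal boundary. -/
def ExtendsContinuouslyTo (H : H3 → H3) (h : RiemannSphere → RiemannSphere) : Prop :=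
  Continuous (ClosedH3.glue H h)

/-- A nice lattice (co-compact torsion-free lattice): a group `Γ` of isometries of hyperbolic
3-space such that the quotient is a compact (Hausdorff) manifold, the projection to the quotient
being a covering map with deck group `Γ`. -/
structure IsNiceLattice (Γ : Subgroup (H3 ≃ᵢ H3)) : Prop where
  covering : IsQuotientCoveringMap (Quotient.mk (MulAction.orbitRel Γ H3)) Γ
  t2 : T2Space (MulAction.orbitRel.Quotient Γ H3)
  compact : CompactSpace (MulAction.orbitRel.Quotient Γ H3)

/-- `H Γ₁ H⁻¹ = Γ₂`, as sets of bijections of hyperbolic space. -/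
def IsEquivariant (H : Equiv.Perm H3) (Γ₁ Γ₂ : Subgroup (H3 ≃ᵢ H3)) : Prop :=
  (fun g : H3 ≃ᵢ H3 => H * g.toEquiv * H⁻¹) '' Γ₁ = (fun g : H3 ≃ᵢ H3 => g.toEquiv) '' Γ₂

/-- The group `Γ` of isometries, acting on the Riemann sphere: the homeomorphisms of the sphere
which are continuous extensions of elements of `Γ`. -/
def boundaryMaps (Γ : Subgroup (H3 ≃ᵢ H3)) : Set (RiemannSphere ≃ₜ RiemannSphere) :=
  {k | ∃ g ∈ Γ, ExtendsContinuouslyTo g k}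

/-- `h Γ₁ h⁻¹ = Γ₂`, as sets of homeomorphisms of the Riemann sphere. -/
def IsBoundaryEquivariant (h : RiemannSphere ≃ₜ RiemannSphere) (Γ₁ Γ₂ : Subgroup (H3 ≃ᵢ H3)) :
    Prop :=
  (fun k => h * k * h⁻¹) '' boundaryMaps Γ₁ = boundaryMaps Γ₂

end

/-! The closed ball embeds in a round sphere by stereographic projection, and in the resulting
chordal metric a hyperbolic step far from the base point o is exponentially short: d(p,q) ≤ 1 gives
chordal length O(exp(-(d(o,p) + d(o,q))/2)) (`dist_chordal_interior_le`). A point of height at most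
r has d(o,p) ≥ -log(2r), and a K-bi-Lipschitz F shrinks this by at most the factor K, up to an
additive constant. So F sends short steps at height at most r to chordal steps O(r^(1/K))
(`exists_dist_chordal_le`).

These bounds sum geometrically down vertical lines, where successive heights halve, so F is Cauchy
at each finite ideal point (`cauchy_map_of_short`). Inversion, an isometry, carries ∞ to 0. The
limits are ideal because F is proper, and density of the interior turns pointwise limits into a
continuous extension.

Extensions compose, and they are unique by density. Applied to H and its inverse this gives a
homeomorphism; composition then carries the conjugacy of the groups to the boundary. -/

open Filter Topology Set

noncomputable section

/-! ### Distance to the base point -/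

namespace H3

/-- The base point of hyperbolic space. -/
def origin : H3 := ⟨0, 1, one_pos⟩

theorem norm_toEuclidean_sq (p : H3) : ‖p.toEuclidean‖ ^ 2 = ‖p.z‖ ^ 2 + p.t ^ 2 := by
  rw [WithLp.prod_norm_sq_eq_of_L2]
  simp [toEuclidean]

theorem cosh_dist_origin (p : H3) :
    Real.cosh (dist origin p) = (1 + ‖p.toEuclidean‖ ^ 2) / (2 * p.t) := by
  have hp := p.t_pos
  have h : dist origin p = 2 * (dist origin p / 2) := by ring
  rw [h, Real.cosh_two_mul, Real.cosh_sq', sinh_half_dist, div_pow, mul_pow,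
    Real.sq_sqrt (by simp [origin, hp.le]), dist_toEuclidean_sq, norm_toEuclidean_sq]
  simp only [origin, dist_zero_left, one_mul]
  field_simp
  ring

theorem dist_toEuclidean_sq_eq_sinh (p q : H3) :
    dist p.toEuclidean q.toEuclidean ^ 2 = 4 * (p.t * q.t) * Real.sinh (dist p q / 2) ^ 2 := by
  have hp := p.t_pos
  have hq := q.t_pos
  rw [sinh_half_dist, div_pow, mul_pow, Real.sq_sqrt (by positivity)]
  field_simp
  norm_num

/-- It follows from 1/(2t) ≤ cosh d ≤ exp d, with t the height of the point and d its distance to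
the base point. -/
theorem neg_log_le_dist_origin {p : H3} {r : ℝ} (h : p.t ≤ r) :
    -Real.log (2 * r) ≤ dist origin p := by
  have hp := p.t_pos
  have hr : 0 < r := hp.trans_le h
  have h1 : (2 * r)⁻¹ ≤ Real.exp (dist origin p) := by
    calc (2 * r)⁻¹ ≤ (2 * p.t)⁻¹ := by gcongr
      _ ≤ Real.cosh (dist origin p) := by
        rw [cosh_dist_origin, inv_eq_one_div]
        gcongr
        nlinarith [sq_nonneg ‖p.toEuclidean‖]
      _ ≤ Real.exp (dist origin p) := by
        rw [Real.cosh_eq]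
        have : Real.exp (-dist origin p) ≤ Real.exp (dist origin p) :=
          Real.exp_le_exp.2 (by linarith [dist_nonneg (x := origin) (y := p)])
        linarith
  rw [← Real.log_inv]
  exact (Real.log_le_iff_le_exp (by positivity)).2 h1

end H3

/-! ### Stereographic projection and the chordal metric -/

section Chordal

variable {E : Type*} [NormedAddCommGroup E] [InnerProductSpace ℝ E]

/-- Inverse stereographic projection onto a sphere of diameter one. -/
def chordalMap (x : E) : E × ℝ := ((1 + ‖x‖ ^ 2)⁻¹ • x, (1 + ‖x‖ ^ 2)⁻¹)

/-- For the Euclidean norm on `E × ℝ` this is the classical chordal identity, proved as `key`; only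
an inequality survives for the sup norm of the product. -/
theorem dist_chordalMap_sq_le (x y : E) :
    dist (chordalMap x) (chordalMap y) ^ 2 ≤ dist x y ^ 2 / ((1 + ‖x‖ ^ 2) * (1 + ‖y‖ ^ 2)) := by
  have hx : (0 : ℝ) < 1 + ‖x‖ ^ 2 := by positivity
  have hy : (0 : ℝ) < 1 + ‖y‖ ^ 2 := by positivity
  have key : dist (chordalMap x).1 (chordalMap y).1 ^ 2 +
      dist (chordalMap x).2 (chordalMap y).2 ^ 2 =
      dist x y ^ 2 / ((1 + ‖x‖ ^ 2) * (1 + ‖y‖ ^ 2)) := by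
    simp only [chordalMap, dist_eq_norm, Real.norm_eq_abs, sq_abs]
    rw [norm_sub_sq_real, norm_sub_sq_real, norm_smul, norm_smul, real_inner_smul_left,
      real_inner_smul_right, mul_pow, mul_pow, Real.norm_eq_abs, Real.norm_eq_abs, sq_abs, sq_abs]
    field_simp
    ring
  rw [Prod.dist_eq]
  rcases max_choice (dist (chordalMap x).1 (chordalMap y).1)
    (dist (chordalMap x).2 (chordalMap y).2) with h | h <;> rw [h, ← key]
  · exact le_add_of_nonneg_right (sq_nonneg _)
  · exact le_add_of_nonneg_left (sq_nonneg _)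

theorem chordalMap_injective : Function.Injective (chordalMap : E → E × ℝ) := by
  intro x y h
  simp only [chordalMap, Prod.mk.injEq] at h
  rw [← h.2] at h
  exact smul_right_injective E (inv_ne_zero (by positivity)) h.1

theorem chordalMap_ne_zero (x : E) : chordalMap x ≠ 0 := fun h =>
  inv_ne_zero (by positivity : (1 + ‖x‖ ^ 2) ≠ 0) (congrArg Prod.snd h)

theorem continuous_chordalMap : Continuous (chordalMap : E → E × ℝ) := by
  have : Continuous fun x : E => (1 + ‖x‖ ^ 2)⁻¹ :=
    (by fun_prop : Continuous fun x : E => 1 + ‖x‖ ^ 2).inv₀ fun x => by positivity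
  exact (this.smul continuous_id).prodMk this

theorem norm_chordalMap_le {x : E} (hx : x ≠ 0) : ‖chordalMap x‖ ≤ max ‖x‖⁻¹ (‖x‖⁻¹ ^ 2) := by
  have h : 0 < ‖x‖ := norm_pos_iff.2 hx
  have h2 : (1 + ‖x‖ ^ 2)⁻¹ ≤ ‖x‖⁻¹ ^ 2 := by
    rw [inv_pow]
    exact inv_anti₀ (by positivity) (by linarith)
  rw [Prod.norm_def]
  refine max_le_max ?_ ?_
  · simp only [chordalMap, norm_smul, norm_inv]
    rw [Real.norm_of_nonneg (by positivity)]
    calc (1 + ‖x‖ ^ 2)⁻¹ * ‖x‖ ≤ ‖x‖⁻¹ ^ 2 * ‖x‖ := by gcongr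
      _ = ‖x‖⁻¹ := by field_simp
  · simp only [chordalMap, norm_inv]
    rw [Real.norm_of_nonneg (by positivity)]
    exact h2

end Chordal

/-! ### Chordal embedding of the closed ball -/

namespace ClosedH3

/-- The embedding of the closed half space with infinity in a sphere. -/
def chordalOnePoint (x : OnePoint (ℂ × ℝ)) : WithLp 2 (ℂ × ℝ) × ℝ :=
  x.elim 0 fun v => chordalMap (WithLp.toLp 2 v)

theorem chordalOnePoint_injective : Function.Injective chordalOnePoint := by
  intro x y h
  induction x using OnePoint.rec <;> induction y using OnePoint.rec
  · rfl
  · exact absurd h.symm (chordalMap_ne_zero _)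
  · exact absurd h (chordalMap_ne_zero _)
  · exact congrArg _ (WithLp.toLp_injective 2 (chordalMap_injective h))

theorem continuous_chordalOnePoint : Continuous chordalOnePoint := by
  rw [OnePoint.continuous_iff]
  constructor
  · rw [coclosedCompact_eq_cocompact]
    have h1 : Tendsto (fun v : ℂ × ℝ => ‖(WithLp.toLp 2 v : WithLp 2 (ℂ × ℝ))‖)
        (cocompact _) atTop :=
      (tendsto_norm_cocompact_atTop (E := WithLp 2 (ℂ × ℝ))).comp
        (WithLp.homeomorphProd 2 ℂ ℝ).symm.isClosedEmbedding.tendsto_cocompact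
    have h2 := h1.inv_tendsto_atTop
    have h3 : Tendsto (fun v : ℂ × ℝ => max ‖(WithLp.toLp 2 v : WithLp 2 (ℂ × ℝ))‖⁻¹
        (‖(WithLp.toLp 2 v : WithLp 2 (ℂ × ℝ))‖⁻¹ ^ 2)) (cocompact _) (𝓝 0) := by
      simpa using h2.max (h2.pow 2)
    refine squeeze_zero_norm' ?_ h3
    filter_upwards [h1.eventually_gt_atTop 0] with v hv
    exact norm_chordalMap_le (norm_pos_iff.1 hv)
  · exact continuous_chordalMap.comp (WithLp.prod_continuous_toLp 2 ℂ ℝ)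

theorem toOnePoint_injective : Function.Injective toOnePoint := by
  rintro (p | ξ) (q | η) h
  · simp only [toOnePoint, OnePoint.coe_eq_coe, Prod.mk.injEq] at h
    rw [H3.ext h.1 h.2]
  · induction η using OnePoint.rec
    · simp [toOnePoint] at h
    · simp only [toOnePoint, OnePoint.map_some, OnePoint.coe_eq_coe, Prod.mk.injEq] at h
      exact absurd h.2 p.t_pos.ne'
  · induction ξ using OnePoint.rec
    · simp [toOnePoint] at h
    · simp only [toOnePoint, OnePoint.map_some, OnePoint.coe_eq_coe, Prod.mk.injEq] at h
      exact absurd h.2.symm q.t_pos.ne'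
  · have : Function.Injective fun z : ℂ => ((z, 0) : ℂ × ℝ) := fun a b hab =>
      congrArg Prod.fst hab
    rw [Option.map_injective this h]

theorem range_toOnePoint : range toOnePoint = ((↑) '' {v : ℂ × ℝ | v.2 < 0})ᶜ := by
  ext x
  induction x using OnePoint.rec with
  | infty =>
    simp only [mem_compl_iff, OnePoint.infty_notMem_image_coe, not_false_eq_true, iff_true]
    exact ⟨ideal OnePoint.infty, rfl⟩
  | coe v =>
    simp only [mem_compl_iff, mem_image, OnePoint.coe_eq_coe, exists_eq_right, mem_ofPred_eq, not_lt]
    constructor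
    · rintro ⟨p | ξ, h⟩
      · simp only [toOnePoint, OnePoint.coe_eq_coe] at h
        rw [← h]
        exact p.t_pos.le
      · induction ξ using OnePoint.rec
        · simp [toOnePoint] at h
        · simp only [toOnePoint, OnePoint.map_some, OnePoint.coe_eq_coe] at h
          rw [← h]
    · intro h
      rcases h.lt_or_eq with h | h
      · exact ⟨interior ⟨v.1, v.2, h⟩, rfl⟩
      · refine ⟨ideal (v.1 : ℂ), ?_⟩
        simp only [toOnePoint, OnePoint.map_some, h]

theorem isClosedEmbedding_toOnePoint : IsClosedEmbedding toOnePoint where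
  eq_induced := rfl
  injective := toOnePoint_injective
  isClosed_range := by
    rw [range_toOnePoint, isClosed_compl_iff]
    exact OnePoint.isOpenEmbedding_coe.isOpenMap _ (isOpen_lt continuous_snd continuous_const)

instance : CompactSpace ClosedH3 := isClosedEmbedding_toOnePoint.compactSpace

instance : T2Space ClosedH3 := isClosedEmbedding_toOnePoint.isEmbedding.t2Space

/-- The chordal embedding of closed hyperbolic space. -/
def chordal (x : ClosedH3) : WithLp 2 (ℂ × ℝ) × ℝ := chordalOnePoint (toOnePoint x)

theorem chordal_interior (p : H3) : chordal (interior p) = chordalMap p.toEuclidean := rfl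

theorem isClosedEmbedding_chordal : IsClosedEmbedding chordal :=
  (continuous_chordalOnePoint.comp isClosedEmbedding_toOnePoint.continuous).isClosedEmbedding
    (chordalOnePoint_injective.comp toOnePoint_injective)

/-- The heights cancel between |p - q|² = 4ts sinh²(d/2) and 1 + |p|² = 2t cosh d(o,p), so the
squared chordal distance is at most sinh²(d/2) / (cosh d(o,p) cosh d(o,q)); then cosh x ≥ exp(x)/2.
-/
theorem dist_chordal_interior_le (p q : H3) :
    dist (chordal (interior p)) (chordal (interior q)) ≤ 2 * Real.sinh (dist p q / 2) *
      Real.exp (-((dist H3.origin p + dist H3.origin q) / 2)) := by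
  have hp := p.t_pos
  have hq := q.t_pos
  have hs : 0 ≤ Real.sinh (dist p q / 2) := Real.sinh_nonneg_iff.2 (by positivity)
  have exp_le (x : ℝ) : Real.exp x / 2 ≤ Real.cosh x := by
    rw [Real.cosh_eq]
    linarith [Real.exp_pos (-x)]
  refine (sq_le_sq₀ dist_nonneg (by positivity)).1 ((dist_chordalMap_sq_le _ _).trans ?_)
  have h : dist p.toEuclidean q.toEuclidean ^ 2 /
      ((1 + ‖p.toEuclidean‖ ^ 2) * (1 + ‖q.toEuclidean‖ ^ 2)) =
      Real.sinh (dist p q / 2) ^ 2 /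
        (Real.cosh (dist H3.origin p) * Real.cosh (dist H3.origin q)) := by
    rw [H3.dist_toEuclidean_sq_eq_sinh, H3.cosh_dist_origin, H3.cosh_dist_origin]
    field_simp
    norm_num
  calc _ = _ := h
    _ ≤ Real.sinh (dist p q / 2) ^ 2 /
        (Real.exp (dist H3.origin p) / 2 * (Real.exp (dist H3.origin q) / 2)) := by
      gcongr <;> apply exp_le
    _ = _ := by
      rw [mul_pow, mul_pow, ← Real.exp_nat_mul]
      rw [show ((2 : ℕ) : ℝ) * -((dist H3.origin p + dist H3.origin q) / 2) =
        -(dist H3.origin p + dist H3.origin q) by push_cast; ring, Real.exp_neg, Real.exp_add]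
      field_simp

end ClosedH3

/-! ### Coordinate topology and inversion -/

namespace H3

/-- The coordinates of a point of the upper half space. -/
def coords (p : H3) : ℂ × ℝ := (p.z, p.t)

theorem tendsto_dist_of_tendsto_coords (p : H3) :
    Tendsto (fun q => dist q p) (comap coords (𝓝 p.coords)) (𝓝 0) := by
  have hp := p.t_pos
  let g : ℂ × ℝ → ℝ := fun v => 2 * Real.arsinh
    (dist (WithLp.toLp 2 v : WithLp 2 (ℂ × ℝ)) p.toEuclidean / (2 * √(v.2 * p.t)))
  have hg : ContinuousAt g p.coords := by
    have h1 : Continuous fun v : ℂ × ℝ =>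
        dist (WithLp.toLp 2 v : WithLp 2 (ℂ × ℝ)) p.toEuclidean :=
      (WithLp.prod_continuous_toLp 2 ℂ ℝ).dist continuous_const
    have h2 : Continuous fun v : ℂ × ℝ => 2 * √(v.2 * p.t) := by fun_prop
    have h3 : 2 * √(p.coords.2 * p.t) ≠ 0 :=
      mul_ne_zero two_ne_zero (Real.sqrt_pos.2 (mul_pos hp hp)).ne'
    exact (Real.continuous_arsinh.continuousAt.comp (h1.continuousAt.div h2.continuousAt h3)).const_mul 2
  have hg0 : g p.coords = 0 := by
    change dist p p = 0
    exact dist_self p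
  have := hg.tendsto
  rw [hg0] at this
  exact this.comp tendsto_comap

/-- Inversion in the unit sphere. -/
def inversion (p : H3) : H3 where
  z := (‖p.z‖ ^ 2 + p.t ^ 2)⁻¹ • p.z
  t := (‖p.z‖ ^ 2 + p.t ^ 2)⁻¹ * p.t
  t_pos := by
    have := p.t_pos
    positivity

/-- Inversion divides |p - q|² and the product of the heights by the same factor |p|²|q|², so their
ratio is preserved. -/
theorem dist_inversion (p q : H3) : dist p.inversion q.inversion = dist p q := by
  have hp := p.t_pos
  have hq := q.t_pos
  have h : Real.sinh (dist p.inversion q.inversion / 2) = Real.sinh (dist p q / 2) := by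
    rw [← sq_eq_sq₀ (Real.sinh_nonneg_iff.2 (by positivity))
      (Real.sinh_nonneg_iff.2 (by positivity))]
    rw [sinh_half_dist, sinh_half_dist, div_pow, div_pow, mul_pow, mul_pow,
      Real.sq_sqrt (mul_pos p.inversion.t_pos q.inversion.t_pos).le,
      Real.sq_sqrt (mul_pos hp hq).le, dist_toEuclidean_sq, dist_toEuclidean_sq,
      dist_eq_norm, dist_eq_norm]
    have hP : 0 < ‖p.z‖ ^ 2 + p.t ^ 2 := by positivity
    have hQ : 0 < ‖q.z‖ ^ 2 + q.t ^ 2 := by positivity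
    simp only [inversion]
    rw [norm_sub_sq_real, norm_sub_sq_real, norm_smul, norm_smul, real_inner_smul_left,
      real_inner_smul_right, Real.norm_of_nonneg (by positivity), Real.norm_of_nonneg (by positivity)]
    field_simp
    ring
  have := Real.sinh_injective h
  linarith

theorem inversion_inversion (p : H3) : p.inversion.inversion = p := by
  have hp := p.t_pos
  have hP : 0 < ‖p.z‖ ^ 2 + p.t ^ 2 := by positivity
  have h : ‖p.inversion.z‖ ^ 2 + p.inversion.t ^ 2 = (‖p.z‖ ^ 2 + p.t ^ 2)⁻¹ := by
    simp only [inversion, norm_smul]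
    rw [Real.norm_of_nonneg (by positivity)]
    field_simp
  ext1
  · change (‖p.inversion.z‖ ^ 2 + p.inversion.t ^ 2)⁻¹ • p.inversion.z = p.z
    rw [h, inv_inv]
    simp only [inversion]
    rw [smul_smul, mul_inv_cancel₀ hP.ne', one_smul]
  · change (‖p.inversion.z‖ ^ 2 + p.inversion.t ^ 2)⁻¹ * p.inversion.t = p.t
    rw [h, inv_inv]
    simp only [inversion]
    field_simp

theorem inversion_origin : origin.inversion = origin := by
  ext1 <;> simp [inversion, origin]

theorem tendsto_coords_inversion :
    Tendsto (fun p => p.inversion.coords) (comap coords (cocompact _)) (𝓝 ((0 : ℂ), (0 : ℝ))) := by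
  rw [show ((0 : ℂ), (0 : ℝ)) = 0 from rfl]
  have h : Tendsto (fun p : H3 => ‖p.coords‖⁻¹) (comap coords (cocompact _)) (𝓝 0) :=
    (tendsto_norm_cocompact_atTop.comp tendsto_comap).inv_tendsto_atTop
  refine squeeze_zero_norm (fun p => ?_) h
  have hp := p.t_pos
  have hc : 0 < ‖p.coords‖ := by
    rw [norm_pos_iff]
    exact fun h => hp.ne' (congrArg Prod.snd h)
  have hP : 0 < ‖p.z‖ ^ 2 + p.t ^ 2 := by positivity
  have h1 : p.inversion.coords = (‖p.z‖ ^ 2 + p.t ^ 2)⁻¹ • p.coords := rfl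
  have h2 : ‖p.coords‖ ^ 2 ≤ ‖p.z‖ ^ 2 + p.t ^ 2 := by
    rw [Prod.norm_def]
    rcases max_choice ‖p.coords.1‖ ‖p.coords.2‖ with h | h <;> rw [h]
    · exact le_add_of_nonneg_right (sq_nonneg _)
    · simp only [coords, Real.norm_eq_abs, sq_abs]
      exact le_add_of_nonneg_left (sq_nonneg _)
  rw [h1, norm_smul, Real.norm_of_nonneg (by positivity)]
  calc (‖p.z‖ ^ 2 + p.t ^ 2)⁻¹ * ‖p.coords‖ ≤ (‖p.coords‖ ^ 2)⁻¹ * ‖p.coords‖ := by gcongr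
    _ = ‖p.coords‖⁻¹ := by field_simp

end H3

/-! ### Hyperbolic space as a dense subspace of the closed ball -/

namespace ClosedH3

open H3

theorem comap_interior_nhds (x : ClosedH3) :
    comap interior (𝓝 x) = comap coords (comap (↑) (𝓝 (toOnePoint x))) := by
  rw [nhds_induced, comap_comap, comap_comap]
  rfl

theorem comap_interior_nhds_interior (p : H3) :
    comap interior (𝓝 (interior p)) = comap coords (𝓝 p.coords) := by
  rw [comap_interior_nhds, show toOnePoint (interior p) = (p.coords : OnePoint (ℂ × ℝ)) from rfl,
    OnePoint.comap_coe_nhds]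

theorem comap_interior_nhds_ideal_coe (z : ℂ) :
    comap interior (𝓝 (ideal z)) = comap coords (𝓝 (z, 0)) := by
  rw [comap_interior_nhds, show toOnePoint (ideal z) = (((z, 0) : ℂ × ℝ) : OnePoint (ℂ × ℝ))
    from rfl, OnePoint.comap_coe_nhds]

theorem comap_interior_nhds_ideal_infty :
    comap interior (𝓝 (ideal OnePoint.infty)) = comap coords (cocompact _) := by
  rw [comap_interior_nhds, show toOnePoint (ideal OnePoint.infty) = OnePoint.infty from rfl,
    OnePoint.comap_coe_nhds_infty, coclosedCompact_eq_cocompact]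

theorem continuous_interior : Continuous interior := by
  rw [isClosedEmbedding_chordal.isInducing.continuous_iff, continuous_iff_continuousAt]
  intro p
  rw [ContinuousAt, tendsto_iff_dist_tendsto_zero]
  have h1 : Continuous fun q : H3 => 2 * Real.sinh (dist q p / 2) *
      Real.exp (-((dist origin q + dist origin p) / 2)) := by
    have : Continuous fun q : H3 => Real.sinh (dist q p / 2) :=
      Real.continuous_sinh.comp (by fun_prop)
    fun_prop
  refine squeeze_zero (fun _ => dist_nonneg) (fun q => dist_chordal_interior_le q p) ?_
  simpa using h1.tendsto p

/-- The metric topology is the coordinate topology: the chordal estimate gives one direction,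
continuity of the distance formula in the coordinates the other. -/
theorem isInducing_interior : IsInducing interior := by
  refine isInducing_iff_nhds.2 fun p => le_antisymm continuous_interior.continuousAt.le_comap ?_
  rw [comap_interior_nhds_interior]
  exact tendsto_id'.1 (tendsto_iff_dist_tendsto_zero.2 (tendsto_dist_of_tendsto_coords p))

theorem isClosedEmbedding_ideal : IsClosedEmbedding ideal := by
  have h : Continuous fun z : ℂ => ((z, 0) : ℂ × ℝ) := by fun_prop
  have hc : IsClosedEmbedding fun z : ℂ => ((z, 0) : ℂ × ℝ) :=
    Function.LeftInverse.isClosedEmbedding (f := Prod.fst) (fun _ => rfl) continuous_fst h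
  refine Continuous.isClosedEmbedding ?_ fun ξ η h => by injection h
  rw [isClosedEmbedding_toOnePoint.isInducing.continuous_iff]
  refine OnePoint.continuous_map h ?_
  rw [coclosedCompact_eq_cocompact, coclosedCompact_eq_cocompact]
  exact hc.tendsto_cocompact

theorem ideal_coe_mem_closure_range_interior (z : ℂ) : ideal z ∈ closure (range interior) := by
  let p (n : ℕ) : H3 := ⟨z, 1 / ((n : ℝ) + 1), by positivity⟩
  have h : Tendsto p atTop (comap interior (𝓝 (ideal z))) := by
    rw [comap_interior_nhds_ideal_coe, tendsto_comap_iff]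
    exact tendsto_const_nhds.prodMk_nhds tendsto_one_div_add_atTop_nhds_zero_nat
  exact mem_closure_of_tendsto (tendsto_comap_iff.1 h)
    (Eventually.of_forall fun n => mem_range_self (p n))

theorem denseRange_interior : DenseRange interior := by
  rintro (p | ξ)
  · exact subset_closure ⟨p, rfl⟩
  · have h := map_mem_closure isClosedEmbedding_ideal.continuous (OnePoint.denseRange_coe ξ)
      (t := closure (range interior)) (by
        rintro _ ⟨z, rfl⟩
        exact ideal_coe_mem_closure_range_interior z)
    rwa [closure_closure] at h

theorem isDenseInducing_interior : IsDenseInducing interior where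
  toIsInducing := isInducing_interior
  dense := denseRange_interior

theorem tendsto_inversion :
    Tendsto inversion (comap interior (𝓝 (ideal OnePoint.infty)))
      (comap interior (𝓝 (ideal (0 : ℂ)))) := by
  rw [comap_interior_nhds_ideal_infty, comap_interior_nhds_ideal_coe, tendsto_comap_iff]
  exact tendsto_coords_inversion

theorem tendsto_dist_origin_coe (z : ℂ) :
    Tendsto (dist origin) (comap interior (𝓝 (ideal z))) atTop := by
  rw [comap_interior_nhds_ideal_coe]
  have h1 : Tendsto (fun p : H3 => p.t) (comap coords (𝓝 (z, 0))) (𝓝 0) :=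
    (continuous_snd.tendsto (z, (0 : ℝ))).comp tendsto_comap
  -- The neighbourhood must be punctured, since `Real.log 0 = 0`.
  have h2 : Tendsto (fun p : H3 => 2 * p.t) (comap coords (𝓝 (z, 0))) (𝓝[≠] 0) := by
    refine tendsto_nhdsWithin_iff.2 ⟨by simpa using h1.const_mul 2, Eventually.of_forall fun p => ?_⟩
    exact mul_ne_zero two_ne_zero p.t_pos.ne'
  exact tendsto_atTop_mono (fun p => neg_log_le_dist_origin le_rfl)
    (tendsto_neg_atBot_atTop.comp (Real.tendsto_log_nhdsNE_zero.comp h2))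

theorem tendsto_dist_origin (ξ : RiemannSphere) :
    Tendsto (dist origin) (comap interior (𝓝 (ideal ξ))) atTop := by
  induction ξ using OnePoint.rec with
  | infty =>
    refine ((tendsto_dist_origin_coe 0).comp tendsto_inversion).congr fun p => ?_
    rw [Function.comp_apply, ← dist_inversion origin p, inversion_origin]
  | coe z => exact tendsto_dist_origin_coe z

end ClosedH3

open ClosedH3

/-! ### Boundary estimates for bi-Lipschitz maps -/

namespace H3

/-- The image of a bi-Lipschitz map in the chordal metric: short steps at height at most `r` are
mapped to chordal steps of order a power of `r`. -/
theorem exists_dist_chordal_le {F : H3 → H3} {K : ℝ} (hK : 1 ≤ K)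
    (hF : ∀ x y, K⁻¹ * dist x y ≤ dist (F x) (F y) ∧ dist (F x) (F y) ≤ K * dist x y) :
    ∃ C, 0 ≤ C ∧ ∀ x y : H3, ∀ r, x.t ≤ r → y.t ≤ r → dist x y ≤ 1 →
      dist (chordal (interior (F x))) (chordal (interior (F y))) ≤ C * r ^ K⁻¹ := by
  have hK0 : 0 < K := by linarith
  have hs : 0 ≤ Real.sinh (K / 2) := Real.sinh_nonneg_iff.2 (by positivity)
  -- The factor sinh(K/2) comes from d(Fx,Fy) ≤ K; the rest, times r^(1/K), is exp(d(o,Fo) +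
  -- log(2r)/K), the inverse exponential of the lower bound `far`.
  refine ⟨2 * Real.sinh (K / 2) * (Real.exp (dist origin (F origin)) * 2 ^ K⁻¹), by positivity,
    fun x y r hx hy hxy => ?_⟩
  have hr : 0 < r := x.t_pos.trans_le hx
  have far (x : H3) (hx : x.t ≤ r) :
      -(Real.log (2 * r) * K⁻¹) - dist origin (F origin) ≤ dist origin (F x) := by
    have h1 := mul_le_mul_of_nonneg_left (neg_log_le_dist_origin hx) (inv_nonneg.2 hK0.le)
    have h2 := (hF origin x).1
    have h3 := dist_triangle (F origin) origin (F x)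
    rw [dist_comm (F origin) origin] at h3
    linarith
  refine (dist_chordal_interior_le _ _).trans ?_
  rw [mul_assoc _ (Real.exp _ * _), mul_assoc (Real.exp _), ← Real.mul_rpow two_pos.le hr.le,
    Real.rpow_def_of_pos (by positivity), ← Real.exp_add]
  have h1 := (hF x y).2
  have h2 := far x hx
  have h3 := far y hy
  gcongr
  · exact Real.sinh_le_sinh.2 (by nlinarith)
  · linarith

/-- The hypothesis says sinh(d/2) ≤ 1/2, and 1/2 ≤ sinh(1/2). -/
theorem dist_le_one {p q : H3} (h : dist p.z q.z ^ 2 + (p.t - q.t) ^ 2 ≤ p.t * q.t) :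
    dist p q ≤ 1 := by
  have hp := p.t_pos
  have hq := q.t_pos
  rw [← dist_toEuclidean_sq, dist_toEuclidean_sq_eq_sinh] at h
  have h1 : Real.sinh (dist p q / 2) ^ 2 ≤ (1 / 2) ^ 2 :=
    le_of_mul_le_mul_left (by linarith) (mul_pos hp hq)
  have h2 : Real.sinh (dist p q / 2) ≤ Real.sinh (1 / 2) :=
    (abs_le_of_sq_le_sq' h1 (by norm_num)).2.trans (Real.self_le_sinh_iff.2 (by norm_num))
  linarith [Real.sinh_le_sinh.1 h2]

/-- Summing a geometric series, short steps along a vertical line control arbitrary ones. -/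
theorem dist_vertical_le_of_short {Y : Type*} [PseudoMetricSpace Y] {f : H3 → Y} {C α : ℝ}
    (hα : 0 < α) (hC : 0 ≤ C)
    (hf : ∀ x y : H3, ∀ r, x.t ≤ r → y.t ≤ r → dist x y ≤ 1 → dist (f x) (f y) ≤ C * r ^ α)
    (z : ℂ) {s t : ℝ} (hs : 0 < s) (ht : 0 < t) (hst : s ≤ t) :
    dist (f ⟨z, s, hs⟩) (f ⟨z, t, ht⟩) ≤ C / (1 - (2 : ℝ)⁻¹ ^ α) * t ^ α := by
  have hc : (2 : ℝ)⁻¹ ^ α < 1 := Real.rpow_lt_one (by norm_num) (by norm_num) hα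
  have hc0 : 0 < (2 : ℝ)⁻¹ ^ α := by positivity
  have hCC : C ≤ C / (1 - (2 : ℝ)⁻¹ ^ α) := by
    rw [le_div_iff₀ (by linarith)]
    nlinarith
  -- Induction on the number of halvings taking height t down to s.
  obtain ⟨n, hn⟩ : ∃ n : ℕ, t ≤ 2 ^ n * s := by
    obtain ⟨n, hn⟩ := pow_unbounded_of_one_lt (t / s) one_lt_two
    exact ⟨n, ((div_lt_iff₀ hs).1 hn).le⟩
  induction n generalizing t with
  | zero =>
    obtain rfl : s = t := le_antisymm hst (by simpa using hn)
    rw [dist_self]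
    have : 0 ≤ C / (1 - (2 : ℝ)⁻¹ ^ α) := hC.trans hCC
    positivity
  | succ n ih =>
    by_cases h : t ≤ 2 * s
    · refine (hf _ _ t hst le_rfl (dist_le_one ?_)).trans (by gcongr)
      simp only [dist_self]
      nlinarith
    · have ht2 : 0 < 2⁻¹ * t := by positivity
      have h1 := ih ht2 (by linarith) (by rw [pow_succ] at hn; linarith)
      have h2 := hf ⟨z, 2⁻¹ * t, ht2⟩ ⟨z, t, ht⟩ t (by simp only; linarith) le_rfl
        (dist_le_one (by simp only [dist_self]; nlinarith))
      -- With c = 2^(-α), the constant D = C/(1 - c) is the fixed point of D = cD + C.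
      refine (dist_triangle _ _ _).trans ((add_le_add h1 h2).trans_eq ?_)
      rw [Real.mul_rpow (by norm_num) ht.le]
      have : 1 - (2 : ℝ)⁻¹ ^ α ≠ 0 := by linarith
      generalize (2 : ℝ)⁻¹ ^ α = c at *
      field_simp
      ring

/-- A map whose short steps at height `r` have size of order a power of `r` is Cauchy at every
finite point of the ideal boundary. -/
theorem cauchy_map_of_short {Y : Type*} [PseudoMetricSpace Y] {f : H3 → Y} {C α : ℝ}
    (hα : 0 < α) (hC : 0 ≤ C)
    (hf : ∀ x y : H3, ∀ r, x.t ≤ r → y.t ≤ r → dist x y ≤ 1 → dist (f x) (f y) ≤ C * r ^ α)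
    (z : ℂ) : Cauchy (map f (comap interior (𝓝 (ideal z)))) := by
  have := isDenseInducing_interior.comap_nhds_neBot (ideal z)
  set D := C / (1 - (2 : ℝ)⁻¹ ^ α) + C
  have key (r : ℝ) (hr : 0 < r) (p : H3) (h1 : dist p.z z < r) (h2 : p.t < r) :
      -- Go up vertically to height r, then horizontally; at that height a Euclidean displacement
      -- below r is a single short step.
      dist (f p) (f ⟨z, r, hr⟩) ≤ D * r ^ α := by
    have h3 := dist_vertical_le_of_short hα hC hf p.z p.t_pos hr h2.le
    have h4 := hf ⟨p.z, r, hr⟩ ⟨z, r, hr⟩ r le_rfl le_rfl (dist_le_one (by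
      simp only [sub_self]
      nlinarith [dist_nonneg (x := p.z) (y := z)]))
    rw [add_mul]
    exact (dist_triangle _ _ _).trans (add_le_add h3 h4)
  refine Metric.cauchy_iff.2 ⟨inferInstance, fun ε hε => ?_⟩
  have hlim : Tendsto (fun r : ℝ => D * r ^ α) (𝓝[>] 0) (𝓝 0) := by
    have h : ContinuousAt (fun r : ℝ => D * r ^ α) 0 :=
      (Real.continuousAt_rpow_const 0 α (Or.inr hα.le)).const_mul D
    have h0 : D * (0 : ℝ) ^ α = 0 := by rw [Real.zero_rpow hα.ne', mul_zero]
    have := h.tendsto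
    rw [h0] at this
    exact this.mono_left nhdsWithin_le_nhds
  obtain ⟨r, hr, hr0⟩ :=
    ((hlim.eventually_lt_const (half_pos hε)).and self_mem_nhdsWithin).exists
  replace hr0 : 0 < r := hr0
  refine ⟨f '' {p | dist p.z z < r ∧ p.t < r}, image_mem_map ?_, ?_⟩
  · rw [comap_interior_nhds_ideal_coe]
    refine ⟨{v | dist v.1 z < r ∧ v.2 < r}, ?_, fun p hp => hp⟩
    refine IsOpen.mem_nhds ?_ ⟨by simpa using hr0, hr0⟩
    exact (isOpen_lt (continuous_fst.dist continuous_const) continuous_const).inter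
      (isOpen_lt continuous_snd continuous_const)
  · rintro _ ⟨p, hp, rfl⟩ _ ⟨q, hq, rfl⟩
    have h1 := key r hr0 p hp.1 hp.2
    have h2 := key r hr0 q hq.1 hq.2
    linarith [dist_triangle_right (f p) (f q) (f ⟨z, r, hr0⟩)]

end H3

/-! ### Existence of the boundary extension -/

theorem IsBL.continuous {X₁ X₂ : Type*} [MetricSpace X₁] [MetricSpace X₂] {F : X₁ → X₂}
    (hF : IsBL F) : Continuous F := by
  obtain ⟨-, K, -, h⟩ := hF
  exact (LipschitzWith.of_dist_le' fun x y => (h x y).2).continuous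

theorem IsBL.symm {X₁ X₂ : Type*} [MetricSpace X₁] [MetricSpace X₂] {F : X₁ ≃ X₂}
    (hF : IsBL F) : IsBL F.symm := by
  obtain ⟨-, K, hK, h⟩ := hF
  have hK0 : 0 < K := by linarith
  refine ⟨F.symm.bijective, K, hK, fun x y => ?_⟩
  have := h (F.symm x) (F.symm y)
  rw [F.apply_symm_apply, F.apply_symm_apply] at this
  constructor
  · rw [inv_mul_le_iff₀ hK0]
    exact this.2
  · rw [← inv_mul_le_iff₀ hK0]
    exact this.1

theorem IsBL.comp_inversion {F : H3 → H3} (hF : IsBL F) : IsBL (F ∘ H3.inversion) := by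
  obtain ⟨hb, K, hK, h⟩ := hF
  refine ⟨hb.comp (Function.Involutive.bijective H3.inversion_inversion), K, hK, fun x y => ?_⟩
  rw [← H3.dist_inversion x y]
  exact h _ _

theorem IsBL.exists_tendsto_coe {F : H3 → H3} (hF : IsBL F) (z : ℂ) :
    ∃ c, Tendsto (interior ∘ F) (comap interior (𝓝 (ideal z))) (𝓝 c) := by
  obtain ⟨-, K, hK, h⟩ := hF
  obtain ⟨C, hC, hF⟩ := H3.exists_dist_chordal_le hK h
  have hcauchy := H3.cauchy_map_of_short (f := fun x => chordal (interior (F x)))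
    (inv_pos.2 (by linarith)) hC hF z
  have hne := isDenseInducing_interior.comap_nhds_neBot (ideal z)
  obtain ⟨c, hc⟩ := CompleteSpace.complete hcauchy
  obtain ⟨c, rfl⟩ : c ∈ range chordal := isClosedEmbedding_chordal.isClosed_range.mem_of_tendsto hc
    (Eventually.of_forall fun x => mem_range_self _)
  exact ⟨c, isClosedEmbedding_chordal.isInducing.tendsto_nhds_iff.2 hc⟩

theorem IsBL.exists_tendsto {F : H3 → H3} (hF : IsBL F) (ξ : RiemannSphere) :
    ∃ c, Tendsto (interior ∘ F) (comap interior (𝓝 (ideal ξ))) (𝓝 c) := by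
  induction ξ using OnePoint.rec with
  | infty =>
    obtain ⟨c, hc⟩ := hF.comp_inversion.exists_tendsto_coe 0
    refine ⟨c, (hc.comp tendsto_inversion).congr fun p => ?_⟩
    simp only [Function.comp_apply, H3.inversion_inversion]
  | coe z => exact hF.exists_tendsto_coe z

theorem IsBL.exists_tendsto_ideal {F : H3 → H3} (hF : IsBL F) (ξ : RiemannSphere) :
    ∃ η, Tendsto (interior ∘ F) (comap interior (𝓝 (ideal ξ))) (𝓝 (ideal η)) := by
  have hne := isDenseInducing_interior.comap_nhds_neBot (ideal ξ)
  obtain ⟨q | η, hc⟩ := hF.exists_tendsto ξ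
  -- An interior limit would keep d(Fo,Fp) bounded, but it is at least d(o,p)/K, which tends to
  -- infinity.
  · have h1 : Tendsto F (comap interior (𝓝 (ideal ξ))) (𝓝 q) :=
      isInducing_interior.tendsto_nhds_iff.2 hc
    have h2 := (tendsto_const_nhds (x := F H3.origin)).dist h1
    obtain ⟨-, K, hK, h⟩ := hF
    have h3 : Tendsto (fun p => dist (F H3.origin) (F p)) (comap interior (𝓝 (ideal ξ))) atTop :=
      tendsto_atTop_mono (fun p => (h H3.origin p).1)
        ((tendsto_dist_origin ξ).const_mul_atTop (inv_pos.2 (by linarith)))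
    exact absurd h2 (not_tendsto_nhds_of_tendsto_atTop h3 _)
  · exact ⟨η, hc⟩

theorem IsBL.exists_extendsContinuouslyTo {F : H3 → H3} (hF : IsBL F) :
    ∃ f, ExtendsContinuouslyTo F f := by
  choose f hf using hF.exists_tendsto_ideal
  have hc : Continuous (interior ∘ F) := continuous_interior.comp hF.continuous
  refine ⟨f, ?_⟩
  have : glue F f = isDenseInducing_interior.extend (interior ∘ F) := by
    funext x
    rcases x with p | ξ
    · exact (isDenseInducing_interior.extend_eq hc p).symm
    · exact (isDenseInducing_interior.extend_eq_of_tendsto (hf ξ)).symm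
  rw [ExtendsContinuouslyTo, this]
  refine isDenseInducing_interior.continuous_extend ?_
  rintro (p | ξ)
  · refine ⟨interior (F p), ?_⟩
    rw [← isInducing_interior.nhds_eq_comap]
    exact hc.tendsto p
  · exact ⟨_, hf ξ⟩

/-! ### Functoriality and uniqueness of extensions -/

namespace ExtendsContinuouslyTo

variable {F G : H3 → H3} {f g : RiemannSphere → RiemannSphere}

theorem comp (hF : ExtendsContinuouslyTo F f) (hG : ExtendsContinuouslyTo G g) :
    ExtendsContinuouslyTo (F ∘ G) (f ∘ g) := by
  have h : glue (F ∘ G) (f ∘ g) = glue F f ∘ glue G g := by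
    funext x
    rcases x <;> rfl
  rw [ExtendsContinuouslyTo, h]
  exact Continuous.comp hF hG

theorem unique (h₁ : ExtendsContinuouslyTo F f) (h₂ : ExtendsContinuouslyTo F g) : f = g := by
  have h : glue F f = glue F g :=
    denseRange_interior.equalizer h₁ h₂ rfl
  funext ξ
  have := congrFun h (ideal ξ)
  injection this

theorem continuous (hF : ExtendsContinuouslyTo F f) : Continuous f := by
  have h : Continuous (glue F f ∘ ideal) := Continuous.comp hF isClosedEmbedding_ideal.continuous
  exact isClosedEmbedding_ideal.isInducing.continuous_iff.2 h

end ExtendsContinuouslyTo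

theorem extendsContinuouslyTo_id : ExtendsContinuouslyTo id id := by
  have h : glue id id = id := by
    funext x
    rcases x <;> rfl
  rw [ExtendsContinuouslyTo, h]
  exact continuous_id

/-- A bi-Lipschitz permutation of hyperbolic space and its inverse extend to mutually inverse
homeomorphisms of the sphere. -/
theorem IsBL.exists_homeomorph {H : Equiv.Perm H3} (hH : IsBL H) :
    ∃ h : RiemannSphere ≃ₜ RiemannSphere,
      ExtendsContinuouslyTo H h ∧ ExtendsContinuouslyTo H.symm h.symm := by
  obtain ⟨f, hf⟩ := hH.exists_extendsContinuouslyTo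
  obtain ⟨g, hg⟩ := hH.symm.exists_extendsContinuouslyTo
  have hgf : g ∘ f = id := by
    have := hg.comp hf
    rw [H.symm_comp_self] at this
    exact this.unique extendsContinuouslyTo_id
  have hfg : f ∘ g = id := by
    have := hf.comp hg
    rw [H.self_comp_symm] at this
    exact this.unique extendsContinuouslyTo_id
  exact ⟨⟨⟨f, g, congrFun hgf, congrFun hfg⟩, hf.continuous, hg.continuous⟩, hf, hg⟩

end

/-! ### Extension and equivariance on the sphere -/

theorem theorem2 (H : Equiv.Perm H3) (hH : IsBL H) :
    ∃ h : RiemannSphere ≃ₜ RiemannSphere, ExtendsContinuouslyTo H h ∧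
      ∀ Γ₁ Γ₂ : Subgroup (H3 ≃ᵢ H3), IsNiceLattice Γ₁ → IsNiceLattice Γ₂ →
        IsEquivariant H Γ₁ Γ₂ → IsBoundaryEquivariant h Γ₁ Γ₂ := by
  obtain ⟨h, hh, hh'⟩ := hH.exists_homeomorph
  refine ⟨h, hh, fun Γ₁ Γ₂ _ _ heq => Subset.antisymm ?_ ?_⟩
  · rintro _ ⟨k, ⟨g, hg, hk⟩, rfl⟩
    obtain ⟨g', hg', hgg'⟩ := heq.subset (mem_image_of_mem _ hg)
    refine ⟨g', hg', ?_⟩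
    have e : (g' : H3 → H3) = (H ∘ g) ∘ H.symm := congrArg (fun φ : Equiv.Perm H3 => ⇑φ) hgg'
    rw [e]
    exact (hh.comp hk).comp hh'
  · rintro k ⟨g', hg', hk⟩
    obtain ⟨g, hg, hgg'⟩ := heq.superset (mem_image_of_mem _ hg')
    -- The preimage of k is forced by conjugation; it extends H⁻¹g'H = g.
    refine ⟨h⁻¹ * k * h, ⟨g, hg, ?_⟩, by simp only; group⟩
    have e : (g : H3 → H3) = (H.symm ∘ g') ∘ H := by
      have : (H ∘ g) ∘ H.symm = (g' : H3 → H3) := congrArg (fun φ : Equiv.Perm H3 => ⇑φ) hgg'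
      rw [← this]
      funext x
      simp
    rw [e]
    exact (hh'.comp hk).comp hh
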